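/- Let $c>1$ be a real number that is not an integer and let $m\ge 2$ be an integer. Consider the sequence $a(n)=\lfloor n^c\rfloor \bmod m$, $n=0,1,2,\dots$, with values in $\{0,1,\dots,m-1\}$. Then, for every positive integer $H$, at least $H^2/4$ distinct words of length $H$ occur in $a$, that is, $$\bigl|\{(a(n),a(n+1),\dots,a(n+H-1)) : n\ge 0\}\bigr| \ge \frac{H^2}{4}.$$ Moreover, the sequence $a$ is not automatic: there is no integer $k\ge 2$ for which some finite deterministic automaton with output, reading the base-$k$ expansion of $n$ starting with the most significant digit, outputs $a(n)$ for every $n\ge 0$. -/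

import Mathlib

/-- The set of words of length `H` that occur in the sequence `a` as contiguous blocks
`(a n, a (n + 1), …, a (n + H - 1))`, `n ≥ 0`. -/
def wordsOfLength {A : Type*} (a : ℕ → A) (H : ℕ) : Set (Fin H → A) :=
  Set.range fun n : ℕ => fun h : Fin H => a (n + h)

/-- The subword complexity `N_H(a)` of a sequence `a` that takes finitely many values:
the number of distinct words of length `H` that occur in `a`. -/
noncomputable def subwordComplexity {A : Type*} (a : ℕ → A) (H : ℕ) : ℕ :=
  (wordsOfLength a H).ncard

/-- A deterministic automaton with output: input alphabet `α`, states `σ`, outputs in `A`. -/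
structure DFAO (α σ A : Type*) where
  /-- The transition function: from every state there is one edge for each letter. -/
  step : σ → α → σ
  /-- The initial state. -/
  start : σ
  /-- The output attached to each state. -/
  output : σ → A

/-- The output of the automaton after reading the word `w` from left to right. -/
def DFAO.run {α σ A : Type*} (M : DFAO α σ A) (w : List α) : A :=
  M.output (w.foldl M.step M.start)

/-- The base-`k` expansion of `n` without leading zeros, most significant digit first
(the expansion of `0` is the empty word). -/
def baseExpansion (k : ℕ) (hk : 2 ≤ k) (n : ℕ) : List (Fin k) :=
  (Nat.digits k n).reverse.pmap (fun d hd => ⟨d, hd⟩)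
    fun _ hd => Nat.digits_lt_base hk (List.mem_reverse.mp hd)

/-- The sequence `a` is `k`-automatic: some finite automaton with output that reads the base-`k`
expansion of `n`, most significant digit first, outputs `a n`, for every `n`. -/
def IsKAutomatic {A : Type*} (k : ℕ) (hk : 2 ≤ k) (a : ℕ → A) : Prop :=
  ∃ (σ : Type) (_ : Finite σ) (M : DFAO (Fin k) σ A), ∀ n : ℕ, a n = M.run (baseExpansion k hk n)

/-- The sequence `a` is automatic: it is `k`-automatic for some base `k ≥ 2`. -/
def IsAutomatic {A : Type*} (a : ℕ → A) : Prop :=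
  ∃ (k : ℕ) (hk : 2 ≤ k), IsKAutomatic k hk a

/-- The sequence `n ↦ ⌊n ^ c⌋ mod m`, with values in `{0, 1, …, m - 1}` for `m ≥ 1`. -/
noncomputable def floorPowMod (c : ℝ) (m : ℕ) (n : ℕ) : ℤ :=
  ⌊(n : ℝ) ^ c⌋ % (m : ℤ)

open Filter Topology fwdDiff

/-!
The `d`-th difference `Δ ^ d (n ^ c)`, where `d = ⌊c⌋ ≥ 1`, tends to infinity with steps tending to
zero, so it stays as close as one likes to any prescribed real modulo one for as long as one likes.
This property passes from `Δ u` to `u`: where the steps of `u` stay near a small positive number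
modulo one, `u` slowly travels around the circle and lingers at every point.

Since adding a linear function to `n ^ c` only changes its first difference by a constant, there are
long blocks on which `n ^ c / m` is modulo one close to any given line. Multiplying by `m` and
taking integer parts, every word `h ↦ ⌊(h + r) / j⌋ mod m` occurs. The positions of their first two
jumps distinguish at least `H ^ 2 / 4` of these words of length `H`. The words of length `H` in an
automatic sequence, on the other hand, number `O(H)`.
-/

section Thick

/-- A set of natural numbers is thick if it contains arbitrarily long blocks of consecutive
integers. -/
def IsThick (S : Set ℕ) : Prop :=
  ∀ L : ℕ, ∃ N : ℕ, ∀ n ≤ L, N + n ∈ S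

theorem IsThick.exists_mul_add_mem {S : Set ℕ} (hS : IsThick S) {q : ℕ} (hq : 0 < q) (L : ℕ) :
    ∃ N : ℕ, ∀ n ≤ L, q * N + n ∈ S := by
  obtain ⟨N, hN⟩ := hS (L + q)
  have hdiv := Nat.div_add_mod N q
  have hmod := Nat.mod_lt N hq
  refine ⟨N / q + 1, fun n hn => ?_⟩
  have hle : q - N % q + n ≤ L + q := by omega
  convert hN _ hle using 1
  rw [mul_add]
  omega

end Thick

section DwellsModOne

variable {u : ℕ → ℝ}

/-- A real sequence dwells modulo one if, for every real `t` and every `ε > 0`, it stays within `ε`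
of `t` modulo one on arbitrarily long blocks of consecutive indices. This strengthens density
modulo one. -/
def DwellsModOne (u : ℕ → ℝ) : Prop :=
  ∀ t ε : ℝ, 0 < ε → IsThick {n | ∃ z : ℤ, |u n - (t + z)| ≤ ε}

/-- A real sequence diverges slowly if it tends to infinity and its differences tend to zero, as for
`n ↦ √n` or `n ↦ log n`. -/
def DivergesSlowly (u : ℕ → ℝ) : Prop :=
  Tendsto u atTop atTop ∧ Tendsto (Δ_[1] u) atTop (𝓝 0)

theorem DwellsModOne.add_const (hu : DwellsModOne u) (s : ℝ) : DwellsModOne fun n => u n + s := by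
  intro t ε hε L
  obtain ⟨N, hN⟩ := hu (t - s) ε hε L
  refine ⟨N, fun n hn => (hN n hn).imp fun z hz => ?_⟩
  convert hz using 2
  ring

theorem DivergesSlowly.const_smul (hu : DivergesSlowly u) {g : ℝ} (hg : 0 < g) :
    DivergesSlowly (g • u) := by
  refine ⟨hu.1.const_mul_atTop hg, ?_⟩
  rw [fwdDiff_const_smul, ← smul_zero g]
  exact hu.2.const_smul g

theorem exists_abs_sub_le_of_abs_step_le {η y : ℝ} {K : ℕ}
    (hstep : ∀ n < K, |u (n + 1) - u n| ≤ η) (hη : 0 ≤ η) (h₀ : u 0 ≤ y) (hK : y ≤ u K) :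
    ∃ n ≤ K, |u n - y| ≤ η := by
  induction K with
  | zero => exact ⟨0, le_rfl, by rwa [le_antisymm h₀ hK, sub_self, abs_zero]⟩
  | succ K ih =>
    rcases le_total y (u K) with hy | hy
    · obtain ⟨n, hn, hny⟩ := ih (fun n hn => hstep n (by omega)) hy
      exact ⟨n, by omega, hny⟩
    · refine ⟨K + 1, le_rfl, ?_⟩
      rw [abs_of_nonneg (by linarith)]
      linarith [le_of_abs_le (hstep K K.lt_succ_self)]

theorem abs_sub_le_mul_of_abs_step_le {η : ℝ} {N n : ℕ}
    (hstep : ∀ i < N + n, |u (i + 1) - u i| ≤ η) : |u (N + n) - u N| ≤ n * η := by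
  have h := dist_le_Ico_sum_of_dist_le (Nat.le_add_right N n) (f := u) (d := fun _ => η)
    fun {i} _ hi => by rw [dist_comm, Real.dist_eq]; exact hstep i hi
  rwa [Finset.sum_const, Nat.card_Ico, Nat.add_sub_cancel_left, nsmul_eq_mul, dist_comm,
    Real.dist_eq] at h

theorem exists_dwell_of_abs_step_le {η ε : ℝ} {K L : ℕ} (t : ℝ)
    (hstep : ∀ n < K + L, |u (n + 1) - u n| ≤ η) (hη : 0 ≤ η) (hclimb : u 0 + 1 ≤ u K)
    (hε : (L + 1) * η ≤ ε) :
    ∃ (N : ℕ) (z : ℤ), ∀ n ≤ L, |u (N + n) - (t + z)| ≤ ε := by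
  have hceil := Int.ceil_lt_add_one (u 0 - t)
  obtain ⟨N, hNK, hN⟩ := exists_abs_sub_le_of_abs_step_le (y := t + ⌈u 0 - t⌉) (K := K)
    (fun n hn => hstep n (by omega)) hη (by linarith [Int.le_ceil (u 0 - t)]) (by linarith)
  refine ⟨N, ⌈u 0 - t⌉, fun n hn => ?_⟩
  have hdrift : |u (N + n) - u N| ≤ n * η :=
    abs_sub_le_mul_of_abs_step_le fun i hi => hstep i (by omega)
  have hnL : (n : ℝ) * η ≤ L * η := by gcongr
  linarith [abs_sub_le (u (N + n)) (u N) (t + ⌈u 0 - t⌉)]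

theorem DivergesSlowly.dwellsModOne (hu : DivergesSlowly u) : DwellsModOne u := by
  intro t ε hε L
  obtain ⟨η, hη, hηε⟩ : ∃ η > 0, (L + 1) * η ≤ ε :=
    ⟨ε / (L + 1), by positivity, (mul_div_cancel₀ ε (by positivity)).le⟩
  obtain ⟨N, hN⟩ := eventually_atTop.1 (Metric.tendsto_nhds.1 hu.2 η hη)
  have hshift : Tendsto (fun n => u (N + n)) atTop atTop :=
    hu.1.comp (tendsto_add_atTop_nat N |>.congr fun n => add_comm n N)
  obtain ⟨K, hK⟩ := (hshift.eventually_ge_atTop (u N + 1)).exists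
  obtain ⟨M, z, hM⟩ := exists_dwell_of_abs_step_le (u := fun n => u (N + n)) (K := K) t
    (fun n _ => by simpa [fwdDiff, add_assoc] using (hN (N + n) (by omega)).le) hη.le hK hηε
  exact ⟨N + M, fun n hn => ⟨z, by simpa only [add_assoc] using hM n hn⟩⟩

theorem DwellsModOne.of_fwdDiff (hu : DwellsModOne (Δ_[1] u)) : DwellsModOne u := by
  intro t ε hε L
  obtain ⟨θ, hθ, hθε⟩ : ∃ θ > 0, (L + 1) * (2 * θ) ≤ ε :=
    ⟨ε / (2 * (L + 1)), by positivity, le_of_eq (by field_simp)⟩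
  obtain ⟨K, hK⟩ := Archimedean.arch (1 : ℝ) hθ
  obtain ⟨N, hN⟩ := hu (3 / 2 * θ) (1 / 2 * θ) (by positivity) (K + L)
  choose! z hz using hN
  -- Modulo one, `v` is a translate of `u`, but its steps are genuinely small.
  let v : ℕ → ℝ := fun n => u (N + n) - ∑ i ∈ Finset.range n, (z i : ℝ)
  have hstep : ∀ n ≤ K + L, θ ≤ v (n + 1) - v n ∧ v (n + 1) - v n ≤ 2 * θ := by
    intro n hn
    have hzn := abs_le.1 (hz n hn)
    simp only [fwdDiff] at hzn
    simp only [v, Finset.sum_range_succ, ← add_assoc]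
    constructor <;> linarith
  have hclimb : v 0 + 1 ≤ v K := by
    have hsum := Finset.card_nsmul_le_sum (Finset.range K) (fun n => v (n + 1) - v n) θ
      fun n hn => (hstep n (by have := Finset.mem_range.1 hn; omega)).1
    rw [Finset.card_range, Finset.sum_range_sub] at hsum
    linarith
  have habs : ∀ n < K + L, |v (n + 1) - v n| ≤ 2 * θ := fun n hn => by
    obtain ⟨hlow, hup⟩ := hstep n hn.le
    rwa [abs_of_nonneg (hθ.le.trans hlow)]
  obtain ⟨M, w, hM⟩ := exists_dwell_of_abs_step_le t habs (by positivity) hclimb hθε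
  refine ⟨N + M, fun n hn => ⟨w + ∑ i ∈ Finset.range (M + n), z i, ?_⟩⟩
  convert hM n hn using 2
  simp only [v]
  push_cast
  rw [add_assoc N]
  ring

theorem dwellsModOne_of_divergesSlowly_fwdDiff_iter {d : ℕ} (hu : DivergesSlowly (Δ_[1] ^[d] u)) :
    DwellsModOne u := by
  induction d generalizing u with
  | zero => exact hu.dwellsModOne
  | succ d ih => exact (ih hu).of_fwdDiff

theorem dwellsModOne_const_mul_add_linear {d : ℕ} (hu : DivergesSlowly (Δ_[1] ^[d + 1] u)) {g : ℝ}
    (hg : 0 < g) (s : ℝ) : DwellsModOne fun n => g * u n + s * n := by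
  have hdiff : DwellsModOne (g • Δ_[1] u) := by
    refine dwellsModOne_of_divergesSlowly_fwdDiff_iter (d := d) ?_
    rw [fwdDiff_iter_const_smul]
    exact hu.const_smul hg
  refine DwellsModOne.of_fwdDiff ?_
  convert hdiff.add_const s using 2 with n
  simp only [fwdDiff, Pi.smul_apply, smul_eq_mul]
  push_cast
  ring

end DwellsModOne

section IteratedDifferences

theorem fwdDiff_iter_comp_natCast {R G : Type*} [AddCommMonoidWithOne R] [AddCommGroup G]
    (f : R → G) (k : ℕ) :
    Δ_[1] ^[k] (fun n : ℕ => f n) = fun n : ℕ => Δ_[(1 : R)] ^[k] f n := by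
  induction k generalizing f with
  | zero => rfl
  | succ k ih =>
    rw [Function.iterate_succ_apply, Function.iterate_succ_apply, ← ih]
    congr 1 with n
    simp [fwdDiff]

variable {f f' : ℝ → ℝ} {a : ℝ}

theorem hasDerivAt_fwdDiff_iter (hf : ∀ x > a, HasDerivAt f (f' x) x) (k : ℕ) :
    ∀ x > a, HasDerivAt (Δ_[(1 : ℝ)] ^[k] f) (Δ_[(1 : ℝ)] ^[k] f' x) x := by
  induction k generalizing f f' with
  | zero => exact hf
  | succ _ ih =>
    exact ih (f := Δ_[(1 : ℝ)] f) (f' := Δ_[(1 : ℝ)] f') fun x hx =>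
      ((hf (x + 1) (by linarith)).comp_add_const x 1).sub (hf x hx)

theorem exists_fwdDiff_iter_succ_eq (hf : ∀ x > a, HasDerivAt f (f' x) x) (k : ℕ) {x : ℝ}
    (hx : a < x) : ∃ y > x, Δ_[(1 : ℝ)] ^[k + 1] f x = Δ_[(1 : ℝ)] ^[k] f' y := by
  have hderiv := hasDerivAt_fwdDiff_iter hf k
  obtain ⟨y, ⟨hxy, -⟩, hslope⟩ := exists_hasDerivAt_eq_slope _ _ (lt_add_one x)
    (fun y hy => (hderiv y (hx.trans_le hy.1)).continuousAt.continuousWithinAt)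
    (fun y hy => hderiv y (hx.trans hy.1))
  refine ⟨y, hxy, ?_⟩
  rw [Function.iterate_succ_apply', hslope, add_sub_cancel_left, div_one, fwdDiff]

theorem tendsto_fwdDiff_iter_succ (hf : ∀ x > a, HasDerivAt f (f' x) x) {k : ℕ} {l : Filter ℝ}
    (hf' : Tendsto (Δ_[(1 : ℝ)] ^[k] f') atTop l) :
    Tendsto (Δ_[(1 : ℝ)] ^[k + 1] f) atTop l := by
  choose! y hy hfy using fun x (hx : a < x) => exists_fwdDiff_iter_succ_eq hf k hx
  have hytop : Tendsto y atTop atTop :=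
    tendsto_atTop_mono' atTop ((eventually_gt_atTop a).mono fun x hx => (hy x hx).le) tendsto_id
  exact (hf'.comp hytop).congr' ((eventually_gt_atTop a).mono fun x hx => (hfy x hx).symm)

theorem tendsto_fwdDiff_iter_succ_rpow {c : ℝ} {k : ℕ} {l : Filter ℝ}
    (h : Tendsto (c • Δ_[(1 : ℝ)] ^[k] fun x : ℝ => x ^ (c - 1)) atTop l) :
    Tendsto (Δ_[(1 : ℝ)] ^[k + 1] fun x : ℝ => x ^ c) atTop l := by
  refine tendsto_fwdDiff_iter_succ (a := 0) (f' := c • fun x : ℝ => x ^ (c - 1))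
    (fun x hx => Real.hasDerivAt_rpow_const (Or.inl hx.ne')) ?_
  rwa [fwdDiff_iter_const_smul]

theorem tendsto_fwdDiff_iter_rpow_atTop (k : ℕ) {c : ℝ} (hc : k < c) :
    Tendsto (Δ_[(1 : ℝ)] ^[k] fun x : ℝ => x ^ c) atTop atTop := by
  induction k generalizing c with
  | zero => exact tendsto_rpow_atTop (by simpa using hc)
  | succ k ih =>
    push_cast at hc
    have hc₀ : 0 < c := lt_of_le_of_lt (by positivity) hc
    exact tendsto_fwdDiff_iter_succ_rpow ((ih (by linarith)).const_mul_atTop hc₀)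

theorem tendsto_fwdDiff_iter_rpow_zero (k : ℕ) {c : ℝ} (hc : c < k) :
    Tendsto (Δ_[(1 : ℝ)] ^[k] fun x : ℝ => x ^ c) atTop (𝓝 0) := by
  induction k generalizing c with
  | zero => simpa using tendsto_rpow_neg_atTop (y := -c) (by simpa using hc)
  | succ k ih =>
    push_cast at hc
    refine tendsto_fwdDiff_iter_succ_rpow ?_
    rw [← smul_zero c]
    exact (ih (by linarith)).const_smul c

theorem divergesSlowly_fwdDiff_iter_rpow {k : ℕ} {c : ℝ} (hkc : k < c) (hck : c < k + 1) :
    DivergesSlowly (Δ_[1] ^[k] fun n : ℕ => (n : ℝ) ^ c) := by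
  rw [DivergesSlowly, ← Function.iterate_succ_apply' (Δ_[1]),
    fwdDiff_iter_comp_natCast fun x : ℝ => x ^ c, fwdDiff_iter_comp_natCast fun x : ℝ => x ^ c]
  exact ⟨(tendsto_fwdDiff_iter_rpow_atTop k hkc).comp tendsto_natCast_atTop_atTop,
    (tendsto_fwdDiff_iter_rpow_zero (k + 1) (by exact_mod_cast hck)).comp
      tendsto_natCast_atTop_atTop⟩

theorem exists_divergesSlowly_fwdDiff_iter_rpow {c : ℝ} (hc : 1 < c)
    (hc_int : ∀ z : ℤ, c ≠ (z : ℝ)) :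
    ∃ d : ℕ, DivergesSlowly (Δ_[1] ^[d + 1] fun n : ℕ => (n : ℝ) ^ c) := by
  obtain ⟨d, hd⟩ := Nat.exists_eq_add_of_le' ((Nat.one_le_floor_iff c).2 hc.le)
  have hlt : (⌊c⌋₊ : ℝ) < c :=
    (Nat.floor_le (by linarith)).lt_of_ne fun h => hc_int ⌊c⌋₊ (by exact_mod_cast h.symm)
  exact ⟨d, hd ▸ divergesSlowly_fwdDiff_iter_rpow hlt (Nat.lt_floor_add_one c)⟩

end IteratedDifferences

section JumpWords

theorem floor_eq_natCast_div_of_abs_sub_lt {x : ℝ} {p j : ℕ} (hj : 0 < j)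
    (hx : |j * x - (p + 1 / 2)| < 1 / 2) : ⌊x⌋ = (p / j : ℕ) := by
  have hjR : (j : ℝ) ≠ 0 := by exact_mod_cast hj.ne'
  have hp : ⌊j * x⌋ = p := by
    obtain ⟨hlow, hup⟩ := abs_lt.1 hx
    rw [Int.floor_eq_iff, Int.cast_natCast]
    constructor <;> linarith
  rw [← mul_div_cancel_left₀ x hjR, Int.floor_div_natCast, hp, Int.natCast_div]

theorem mem_wordsOfLength_floor_emod {u : ℕ → ℝ} {d : ℕ}
    (hu : DivergesSlowly (Δ_[1] ^[d + 1] u)) {m : ℕ} (hm : 0 < m) {j : ℕ} (hj : 0 < j) (r H : ℕ) :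
    (fun h : Fin H => (((h + r) / j : ℕ) : ℤ) % (m : ℤ)) ∈
      wordsOfLength (fun n => ⌊u n⌋ % (m : ℤ)) H := by
  have hmR : (0 : ℝ) < m := by exact_mod_cast hm
  have hjm : (0 : ℝ) < j * m := mul_pos (by exact_mod_cast hj) hmR
  have hdwell : DwellsModOne fun n => 1 / m * u n + -(1 / (j * m)) * n :=
    dwellsModOne_const_mul_add_linear hu (one_div_pos.2 hmR) _
  -- Starting the block at a multiple of `j * m` makes the linear term an integer there.
  obtain ⟨N, hN⟩ := (hdwell ((r + 1 / 2) / (j * m)) (1 / 4 / (j * m))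
    (by positivity)).exists_mul_add_mem (Nat.mul_pos hj hm) H
  refine ⟨j * m * N, funext fun h => ?_⟩
  obtain ⟨z, hz⟩ := hN h h.2.le
  suffices hfloor : ⌊u (j * m * N + h) - (m * (z + N) : ℤ)⌋ = ((h + r) / j : ℕ) by
    rw [Int.floor_sub_intCast, sub_eq_iff_eq_add] at hfloor
    simp only [hfloor, Int.add_mul_emod_self_left]
  have hscale : j * (u (j * m * N + h) - (m * (z + N) : ℤ)) - ((h + r : ℕ) + 1 / 2) =
      (1 / m * u (j * m * N + h) + -(1 / (j * m)) * (j * m * N + h : ℕ) -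
        ((r + 1 / 2) / (j * m) + z)) * (j * m) := by
    push_cast
    field_simp
    ring
  refine floor_eq_natCast_div_of_abs_sub_lt hj ?_
  rw [hscale, abs_mul, abs_of_pos hjm]
  exact ((le_div_iff₀ hjm).1 hz).trans_lt (by norm_num)

theorem finite_wordsOfLength {A : Type*} {a : ℕ → A} (ha : (Set.range a).Finite) (H : ℕ) :
    (wordsOfLength a H).Finite := by
  refine (Set.Finite.pi' fun _ : Fin H => ha).subset ?_
  rintro _ ⟨n, rfl⟩ h
  exact Set.mem_range_self _

theorem finite_range_emod {m : ℤ} (hm : 0 < m) (v : ℕ → ℤ) :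
    (Set.range fun n => v n % m).Finite := by
  refine (Set.finite_Ico 0 m).subset ?_
  rintro _ ⟨n, rfl⟩
  exact ⟨Int.emod_nonneg _ hm.ne', Int.emod_lt_of_pos _ hm⟩

/-- The word `h ↦ ⌊(h + s - 2 * i) / (s - i)⌋`. For `2 * i ≤ s` it jumps from `0` to `1` at `i` and
from `1` to `2` at `s`; under that assumption the natural subtractions do not truncate. -/
def jumpWord (i s h : ℕ) : ℕ :=
  (h + (s - 2 * i)) / (s - i)

variable {i s h : ℕ}

theorem jumpWord_of_lt (his : 2 * i ≤ s) (hh : h < i) : jumpWord i s h = 0 :=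
  Nat.div_eq_of_lt (by omega)

theorem jumpWord_of_le_of_lt (his : 2 * i ≤ s) (hih : i ≤ h) (hhs : h < s) :
    jumpWord i s h = 1 :=
  Nat.div_eq_of_lt_le (by omega) (by omega)

theorem jumpWord_self (his : 2 * i ≤ s) (hs : 0 < s) : jumpWord i s s = 2 :=
  Nat.div_eq_of_eq_mul_left (by omega) (by omega)

/-- The pairs `⟨s, i⟩` of jump positions for which `jumpWord i s` is determined by its values modulo
`m ≥ 2` on `{0, …, H - 1}`. A second jump at `s = H` is detected by its absence. -/
def jumpPositions (H : ℕ) : Finset (Σ _ : ℕ, ℕ) :=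
  (Finset.Icc 1 H).sigma fun s => Finset.range (s / 2 + 1)

theorem mem_jumpPositions {H : ℕ} {p : Σ _ : ℕ, ℕ} :
    p ∈ jumpPositions H ↔ 0 < p.1 ∧ p.1 ≤ H ∧ 2 * p.2 ≤ p.1 := by
  simp only [jumpPositions, Finset.mem_sigma, Finset.mem_Icc, Finset.mem_range]
  omega

theorem sq_le_four_mul_card_jumpPositions (H : ℕ) : H ^ 2 ≤ 4 * (jumpPositions H).card := by
  simp only [jumpPositions, Finset.card_sigma, Finset.card_range]
  induction H with
  | zero => simp
  | succ H ih =>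
    rw [Finset.sum_Icc_succ_top (by omega)]
    have : 2 * H + 1 ≤ 4 * ((H + 1) / 2 + 1) := by omega
    linarith

theorem natCast_emod_ne_succ_emod {m : ℕ} (hm : 2 ≤ m) (n : ℕ) :
    (n : ℤ) % m ≠ ((n + 1 : ℕ) : ℤ) % m := by
  intro h
  have hdvd : (m : ℤ) ∣ 1 := by simpa using Int.ModEq.dvd h
  have := Int.le_of_dvd one_pos hdvd
  omega

theorem injOn_jumpWord_emod {m : ℕ} (hm : 2 ≤ m) (H : ℕ) :
    Set.InjOn (fun (p : Σ _ : ℕ, ℕ) (h : Fin H) => (jumpWord p.2 p.1 h : ℤ) % m)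
      (jumpPositions H) := by
  rintro ⟨s, i⟩ hp ⟨s', i'⟩ hp' hword
  rw [SetLike.mem_coe, mem_jumpPositions] at hp hp'
  dsimp only at hp hp'
  obtain ⟨hs, hsH, his⟩ := hp
  obtain ⟨hs', hsH', his'⟩ := hp'
  have heq (h : ℕ) (hh : h < H) : (jumpWord i s h : ℤ) % m = (jumpWord i' s' h : ℤ) % m :=
    congrFun hword ⟨h, hh⟩
  have hne₀ := natCast_emod_ne_succ_emod hm 0
  have hne₁ := natCast_emod_ne_succ_emod hm 1
  obtain rfl : i = i' := by
    rcases lt_trichotomy i i' with hlt | rfl | hlt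
    · have h := heq i (by omega)
      rw [jumpWord_of_le_of_lt his le_rfl (by omega), jumpWord_of_lt his' hlt] at h
      exact absurd h.symm hne₀
    · rfl
    · have h := heq i' (by omega)
      rw [jumpWord_of_lt his hlt, jumpWord_of_le_of_lt his' le_rfl (by omega)] at h
      exact absurd h hne₀
  obtain rfl : s = s' := by
    rcases lt_trichotomy s s' with hlt | rfl | hlt
    · have h := heq s (by omega)
      rw [jumpWord_self his hs, jumpWord_of_le_of_lt his' (by omega) hlt] at h
      exact absurd h.symm hne₁
    · rfl
    · have h := heq s' (by omega)
      rw [jumpWord_of_le_of_lt his (by omega) hlt, jumpWord_self his' hs'] at h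
      exact absurd h hne₁
  rfl

theorem sq_div_four_le_subwordComplexity_floor_emod {u : ℕ → ℝ} {d : ℕ}
    (hu : DivergesSlowly (Δ_[1] ^[d + 1] u)) {m : ℕ} (hm : 2 ≤ m) (H : ℕ) :
    (H : ℝ) ^ 2 / 4 ≤ (subwordComplexity (fun n => ⌊u n⌋ % (m : ℤ)) H : ℝ) := by
  have hcard : (jumpPositions H).card ≤ subwordComplexity (fun n => ⌊u n⌋ % (m : ℤ)) H := by
    rw [← Set.ncard_coe_finset]
    refine Set.ncard_le_ncard_of_injOn _ (fun p hp => ?_) (injOn_jumpWord_emod hm H)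
      (finite_wordsOfLength (finite_range_emod (by omega) _) H)
    obtain ⟨hs, -, his⟩ := mem_jumpPositions.1 hp
    exact mem_wordsOfLength_floor_emod hu (by omega) (by omega) _ H
  have hsq : (H : ℝ) ^ 2 ≤ 4 * (jumpPositions H).card := by
    exact_mod_cast sq_le_four_mul_card_jumpPositions H
  have hcardR : ((jumpPositions H).card : ℝ) ≤
      subwordComplexity (fun n => ⌊u n⌋ % (m : ℤ)) H := by exact_mod_cast hcard
  linarith

end JumpWords

section Automatic

variable {A : Type*} {a : ℕ → A}

/-- The words of length `L` that occur in `a` at a position divisible by `L`. -/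
def alignedWordsOfLength (a : ℕ → A) (L : ℕ) : Set (Fin L → A) :=
  Set.range fun q : ℕ => fun r : Fin L => a (L * q + r)

theorem subwordComplexity_le_of_finite_alignedWordsOfLength {H L : ℕ} (hL : 0 < L) (hHL : H ≤ L)
    (hfin : (alignedWordsOfLength a L).Finite) :
    subwordComplexity a H ≤ (alignedWordsOfLength a L).ncard ^ 2 * L := by
  let W := alignedWordsOfLength a L
  let factor : ((Fin L → A) × (Fin L → A)) × Fin L → Fin H → A := fun p h =>
    Fin.append p.1.1 p.1.2 ⟨p.2 + h, by omega⟩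
  have hsub : wordsOfLength a H ⊆ factor '' ((W ×ˢ W) ×ˢ Set.univ) := by
    rintro _ ⟨n, rfl⟩
    refine ⟨((fun r => a (L * (n / L) + r), fun r => a (L * (n / L + 1) + r)),
      ⟨n % L, Nat.mod_lt n hL⟩), ⟨⟨⟨n / L, rfl⟩, ⟨n / L + 1, rfl⟩⟩, Set.mem_univ _⟩, ?_⟩
    have happend (i : Fin (L + L)) : Fin.append (fun r : Fin L => a (L * (n / L) + r))
        (fun r : Fin L => a (L * (n / L + 1) + r)) i = a (L * (n / L) + i) := by
      refine Fin.addCases (fun r => ?_) (fun r => ?_) i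
      · rw [Fin.append_left, Fin.val_castAdd]
      · rw [Fin.append_right, Fin.val_natAdd, mul_add_one, add_assoc]
    funext h
    simp only [factor, happend, ← add_assoc, Nat.div_add_mod]
  calc subwordComplexity a H
    _ ≤ (factor '' ((W ×ˢ W) ×ˢ Set.univ)).ncard :=
        Set.ncard_le_ncard hsub (((hfin.prod hfin).prod Set.finite_univ).image _)
    _ ≤ ((W ×ˢ W) ×ˢ (Set.univ : Set (Fin L))).ncard :=
        Set.ncard_image_le ((hfin.prod hfin).prod Set.finite_univ)
    _ = W.ncard ^ 2 * L := by
        rw [Set.ncard_prod, Set.ncard_prod, Set.ncard_univ, Nat.card_fin, sq]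

theorem exists_baseExpansion_pow_mul_add_eq_append {k : ℕ} (hk : 2 ≤ k) {r s : ℕ}
    (hr : r < k ^ s) :
    ∃ w : List (Fin k), ∀ q > 0,
      baseExpansion k hk (k ^ s * q + r) = baseExpansion k hk q ++ w := by
  refine ⟨List.replicate (s - (Nat.digits k r).length) ⟨0, by omega⟩ ++ baseExpansion k hk r,
    fun q hq => ?_⟩
  have hlen : (Nat.digits k r).length ≤ s := (Nat.digits_length_le_iff hk r).2 hr
  have hdigits := Nat.digits_append_zeroes_append_digits (n := r)
    (k := s - (Nat.digits k r).length) hk hq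
  rw [Nat.add_sub_cancel' hlen, add_comm r] at hdigits
  apply List.map_injective_iff.2 Fin.val_injective
  simp [baseExpansion, List.map_pmap, ← hdigits]

theorem IsKAutomatic.exists_ncard_alignedWordsOfLength_le {k : ℕ} {hk : 2 ≤ k}
    (ha : IsKAutomatic k hk a) :
    ∃ C : ℕ, ∀ s, (alignedWordsOfLength a (k ^ s)).Finite ∧
      (alignedWordsOfLength a (k ^ s)).ncard ≤ C := by
  obtain ⟨σ, _, M, hM⟩ := ha
  refine ⟨Nat.card σ + 1, fun s => ?_⟩
  choose w hw using fun r : Fin (k ^ s) => exists_baseExpansion_pow_mul_add_eq_append hk r.2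
  let wordFrom : σ → Fin (k ^ s) → A := fun x r => M.output ((w r).foldl M.step x)
  -- The block `q = 0` is exceptional because leading zeros are never read.
  have hsub : alignedWordsOfLength a (k ^ s) ⊆
      insert (fun r : Fin (k ^ s) => a (k ^ s * 0 + r)) (Set.range wordFrom) := by
    rintro _ ⟨q, rfl⟩
    rcases q.eq_zero_or_pos with rfl | hq
    · exact Set.mem_insert _ _
    · refine Set.mem_insert_of_mem _ ⟨(baseExpansion k hk q).foldl M.step M.start, ?_⟩
      funext r
      simp only [wordFrom, hM, DFAO.run, hw r q hq, List.foldl_append]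
  have hfin := (Set.finite_range wordFrom).insert fun r : Fin (k ^ s) => a (k ^ s * 0 + r)
  refine ⟨hfin.subset hsub, (Set.ncard_le_ncard hsub hfin).trans ?_⟩
  exact (Set.ncard_insert_le _ _).trans (Nat.add_le_add_right (Finite.card_range_le wordFrom) 1)

theorem IsAutomatic.exists_subwordComplexity_le_mul (ha : IsAutomatic a) :
    ∃ C : ℕ, ∀ H > 0, subwordComplexity a H ≤ C * H := by
  obtain ⟨k, hk, ha⟩ := ha
  obtain ⟨C, hC⟩ := ha.exists_ncard_alignedWordsOfLength_le
  refine ⟨C ^ 2 * k, fun H hH => ?_⟩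
  obtain ⟨hfin, hcard⟩ := hC (Nat.log k H + 1)
  have hlt : H < k ^ (Nat.log k H + 1) := Nat.lt_pow_succ_log_self hk H
  have hle : k ^ (Nat.log k H + 1) ≤ k * H := by
    rw [pow_succ']
    exact Nat.mul_le_mul_left k (Nat.pow_log_le_self k hH.ne')
  calc subwordComplexity a H
    _ ≤ (alignedWordsOfLength a (k ^ (Nat.log k H + 1))).ncard ^ 2 * k ^ (Nat.log k H + 1) :=
        subwordComplexity_le_of_finite_alignedWordsOfLength (by omega) hlt.le hfin
    _ ≤ C ^ 2 * (k * H) := by gcongr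
    _ = C ^ 2 * k * H := by ring

theorem not_isAutomatic_of_sq_div_four_le
    (h : ∀ H : ℕ, (H : ℝ) ^ 2 / 4 ≤ (subwordComplexity a H : ℝ)) : ¬ IsAutomatic a := by
  intro ha
  obtain ⟨C, hC⟩ := ha.exists_subwordComplexity_le_mul
  have hlow := h (4 * C + 1)
  have hup : (subwordComplexity a (4 * C + 1) : ℝ) ≤ C * (4 * C + 1) := by
    exact_mod_cast hC (4 * C + 1) (by omega)
  push_cast at hlow
  have : (0 : ℝ) ≤ C := by positivity
  nlinarith

end Automatic

theorem mainTheorem6_general {u : ℕ → ℝ} {d : ℕ} (hu : DivergesSlowly (Δ_[1] ^[d + 1] u)) {m : ℕ}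
    (hm : 2 ≤ m) :
    (∀ H : ℕ, (H : ℝ) ^ 2 / 4 ≤ (subwordComplexity (fun n => ⌊u n⌋ % (m : ℤ)) H : ℝ)) ∧
      ¬ IsAutomatic fun n => ⌊u n⌋ % (m : ℤ) :=
  have h := sq_div_four_le_subwordComplexity_floor_emod hu hm
  ⟨h, not_isAutomatic_of_sq_div_four_le h⟩

theorem mainTheorem6 (c : ℝ) (hc : 1 < c) (hc_int : ∀ z : ℤ, c ≠ (z : ℝ))
    (m : ℕ) (hm : 2 ≤ m) :
    (∀ H : ℕ, 0 < H → (H : ℝ) ^ 2 / 4 ≤ (subwordComplexity (floorPowMod c m) H : ℝ)) ∧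
      ¬ IsAutomatic (floorPowMod c m) := by
  obtain ⟨d, hd⟩ := exists_divergesSlowly_fwdDiff_iter_rpow hc hc_int
  exact (mainTheorem6_general hd hm).imp_left fun h H _ => h H
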